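/- **Theorem 6.2 (Liouville integrability of the constrained flows).** Let $N\ge 0$ and let $\alpha_1,\alpha_2,\alpha_3$ be distinct real numbers, likewise $\beta_1,\beta_2,\beta_3$, likewise $\gamma_1,\gamma_2,\gamma_3$, and likewise $\lambda_1,\dots,\lambda_N$. On $\mathbb{R}^{6N}$, with coordinates $\phi_{is},\psi_{is}$ ($1\le i\le 3$, $1\le s\le N$), put $\Phi_i=(\phi_{i1},\dots,\phi_{iN})^T$, $\Psi_i=(\psi_{i1},\dots,\psi_{iN})^T$, $\phi^{(s)}=(\phi_{1s},\phi_{2s},\phi_{3s})^T$, $\psi^{(s)}=(\psi_{1s},\psi_{2s},\psi_{3s})^T$, let $\langle\cdot,\cdot\rangle$ be the standard inner product of $\mathbb{R}^N$, and let $$\{f,g\}=\sum_{i=1}^3\Bigl(\Bigl\langle\frac{\partial f}{\partial\Psi_i},\frac{\partial g}{\partial\Phi_i}\Bigr\rangle-\Bigl\langle\frac{\partial f}{\partial\Phi_i},\frac{\partial g}{\partial\Psi_i}\Bigr\rangle\Bigr),\qquad f,g\in C^\infty(\mathbb{R}^{6N}).$$ Let $\widetilde U(\lambda)$ and $\widetilde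 V(\lambda)$ be the $3\times3$ matrices with diagonal entries $\alpha_i\lambda$ and $\beta_i\lambda$, respectively, and with off-diagonal entries $$\tilde u_{ij}=\frac{\alpha_i-\alpha_j}{\gamma_i-\gamma_j}\langle\Phi_i,\Psi_j\rangle\qquad\text{and}\qquad \tilde v_{ij}=\frac{\beta_i-\beta_j}{\alpha_i-\alpha_j}\,\tilde u_{ij}\qquad(i\ne j),$$ respectively. The spatial and the temporal constrained flows are the systems of ordinary differential equations $$\phi^{(s)}_x=\widetilde U(\lambda_s)\phi^{(s)},\quad \psi^{(s)}_x=-\widetilde U(\lambda_s)^T\psi^{(s)},\qquad 1\le s\le N,$$ $$\phi^{(s)}_t=\widetilde V(\lambda_s)\phi^{(s)},\quad \psi^{(s)}_t=-\widetilde V(\lambda_s)^T\psi^{(s)},\qquad 1\le s\le N.$$ Let $L(\lambda)$ be the $3\times 3$ matrix with entries $L(\lambda)_{ij}=\gamma_i\delta_{ij}+\sum_{s=1}^N\frac{\phi_{is}\psi_{js}}{\lambda-\lambda_s}$, write $\det(\nu I_3-L(\lambda))=\nu^3-\mathcal F_1(\lambda)\nu^2+\mathcal F_2(\lambda)\nu-\mathcal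 F_3(\lambda)$, and let $F_{il}$ be the coefficients of the expansions at infinity $\mathcal F_i(\lambda)=\sum_{l\ge0}F_{il}\lambda^{-l}$, which converge for all real $\lambda\ne0$ with $|\lambda|>|\lambda_s|$ for all $s$. Then the $F_{il}$, $1\le i\le3$, $l\ge1$, are smooth functions on $\mathbb{R}^{6N}$. They are integrals of motion of both constrained flows, that is, they are constant along every solution of either flow, and they are pairwise in involution: $\{F_{il},F_{jk}\}=0$ for $1\le i,j\le3$ and $l,k\ge1$. The $3N$ functions $F_{is}$, $1\le i\le3$, $1\le s\le N$, are functionally independent over a dense open subset of $\mathbb{R}^{6N}$, that is, their differentials are linearly independent at each of its points. Consequently both constrained flows are Liouville integrable: each is a Hamiltonian system $\Phi_i'=-\partial H/\partial\Psi_i$, $\Psi_i'=\partial H/\partial\Phi_i$ ($1\le i\le 3$) for a smooth function $H$ on $\mathbb{R}^{6N}$, and each has $3N$ smooth integrals of motion that are pairwise in involution and functionally independent over a dense open subset. -/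

import Mathlib

open scoped Matrix ContDiff

noncomputable section

namespace MultiWave

/-- The phase space `ℝ^{6N}`; a point is `(Φ, Ψ)` with coordinates `Φ i s = φ_{is}` and
`Ψ i s = ψ_{is}`, where `i` runs over three values and `s` over `N` values. -/
abbrev Phase (N : ℕ) : Type := (Fin 3 → Fin N → ℝ) × (Fin 3 → Fin N → ℝ)

/-! ### Symplectic geometry of the phase space -/

/-- The partial derivative `∂f/∂φ_{is}` at `z`. -/
def dPhi {N : ℕ} (f : Phase N → ℝ) (z : Phase N) (i : Fin 3) (s : Fin N) : ℝ :=
  fderiv ℝ f z (Pi.single i (Pi.single s 1), 0)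

/-- The partial derivative `∂f/∂ψ_{is}` at `z`. -/
def dPsi {N : ℕ} (f : Phase N → ℝ) (z : Phase N) (i : Fin 3) (s : Fin N) : ℝ :=
  fderiv ℝ f z (0, Pi.single i (Pi.single s 1))

/-- The Poisson bracket
`{f, g} = ∑ i, (⟨∂f/∂Ψ_i, ∂g/∂Φ_i⟩ - ⟨∂f/∂Φ_i, ∂g/∂Ψ_i⟩)`. -/
def poisson {N : ℕ} (f g : Phase N → ℝ) (z : Phase N) : ℝ :=
  ∑ i : Fin 3, (dPsi f z i ⬝ᵥ dPhi g z i - dPhi f z i ⬝ᵥ dPsi g z i)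

/-- The Hamiltonian vector field of `H`: `Φ_i' = -∂H/∂Ψ_i`, `Ψ_i' = ∂H/∂Φ_i`. -/
def hamiltonianField {N : ℕ} (H : Phase N → ℝ) (z : Phase N) : Phase N :=
  (fun i s => -dPsi H z i s, fun i s => dPhi H z i s)

/-- `f` is an integral of motion of the autonomous system `z' = X z`: it is constant along every
solution on an open interval. -/
def IsIntegralOfMotion {N : ℕ} (X : Phase N → Phase N) (f : Phase N → ℝ) : Prop :=
  ∀ (a b : ℝ) (c : ℝ → Phase N), (∀ t ∈ Set.Ioo a b, HasDerivAt c (X (c t)) t) →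
    ∀ t ∈ Set.Ioo a b, ∀ t' ∈ Set.Ioo a b, f (c t) = f (c t')

/-- The functions `f k` are functionally independent over a dense open subset of the phase space:
their differentials are linearly independent at each point of such a subset. -/
def FunctionallyIndependent {N : ℕ} {ι : Type} (f : ι → Phase N → ℝ) : Prop :=
  ∃ W : Set (Phase N), IsOpen W ∧ Dense W ∧
    ∀ z ∈ W, LinearIndependent ℝ (fun k => fderiv ℝ (f k) z)

/-- The system `z' = X z` on `ℝ^{6N}` is Liouville integrable: it is Hamiltonian with a smooth
Hamiltonian, and it has `3N` smooth integrals of motion which are pairwise in involution and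
functionally independent over a dense open subset. -/
def IsLiouvilleIntegrable {N : ℕ} (X : Phase N → Phase N) : Prop :=
  (∃ H : Phase N → ℝ, ContDiff ℝ ∞ H ∧ X = hamiltonianField H) ∧
  ∃ f : Fin (3 * N) → Phase N → ℝ,
    (∀ k, ContDiff ℝ ∞ (f k)) ∧
    (∀ k, IsIntegralOfMotion X (f k)) ∧
    (∀ k l z, poisson (f k) (f l) z = 0) ∧
    FunctionallyIndependent f

/-! ### The constrained flows -/

/-- The spectral matrix with diagonal `δ i * lam` and off-diagonal entries `w i j`. -/
def spectralMatrix (δ : Fin 3 → ℝ) (w : Fin 3 → Fin 3 → ℝ) (lam : ℝ) :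
    Matrix (Fin 3) (Fin 3) ℝ :=
  Matrix.of fun i j => if i = j then δ i * lam else w i j

/-- The matrix `U(u, lam)` of the spatial spectral problem. -/
def matU (α : Fin 3 → ℝ) (u : Fin 3 → Fin 3 → ℝ) (lam : ℝ) : Matrix (Fin 3) (Fin 3) ℝ :=
  spectralMatrix α u lam

/-- The matrix `V(u, lam)` of the temporal spectral problem; its off-diagonal part
`v_{ij} = (β_i - β_j) / (α_i - α_j) * u_{ij}` is the one determined by `[U₀, V₁] = [V₀, U₁]`. -/
def matV (α β : Fin 3 → ℝ) (u : Fin 3 → Fin 3 → ℝ) (lam : ℝ) : Matrix (Fin 3) (Fin 3) ℝ :=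
  spectralMatrix β (fun i j => (β i - β j) / (α i - α j) * u i j) lam

/-- The constrained potential
`ũ_{ij} = (α_i - α_j) / (γ_i - γ_j) * ⟨Φ_i, Ψ_j⟩` (used for `i ≠ j` only). -/
def constrainedPotential {N : ℕ} (α γ : Fin 3 → ℝ) (z : Phase N) (i j : Fin 3) : ℝ :=
  (α i - α j) / (γ i - γ j) * (z.1 i ⬝ᵥ z.2 j)

/-- The vector field of the system `φ^{(s)}' = M(z, λ_s) φ^{(s)}`,
`ψ^{(s)}' = -M(z, λ_s)ᵀ ψ^{(s)}`, `1 ≤ s ≤ N`, for a matrix `M` depending on the point. -/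
def binaryField {N : ℕ} (lam : Fin N → ℝ) (M : Phase N → ℝ → Matrix (Fin 3) (Fin 3) ℝ)
    (z : Phase N) : Phase N :=
  (fun i s => (M z (lam s) *ᵥ fun j => z.1 j s) i,
   fun i s => (-(M z (lam s))ᵀ *ᵥ fun j => z.2 j s) i)

/-- The spatial constrained flow. -/
def spatialFlow {N : ℕ} (α γ : Fin 3 → ℝ) (lam : Fin N → ℝ) : Phase N → Phase N :=
  binaryField lam fun z => matU α (constrainedPotential α γ z)

/-- The temporal constrained flow. -/
def temporalFlow {N : ℕ} (α β γ : Fin 3 → ℝ) (lam : Fin N → ℝ) : Phase N → Phase N :=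
  binaryField lam fun z => matV α β (constrainedPotential α γ z)

/-! ### The Lax operator and the functions `F_{il}` -/

/-- The coefficient `𝓕_{i+1}` (`i = 0, 1, 2`) in
`det (ν I - M) = ν³ - 𝓕₁ ν² + 𝓕₂ ν - 𝓕₃`. -/
def charCoeff {R : Type} [CommRing R] (M : Matrix (Fin 3) (Fin 3) R) (i : Fin 3) : R :=
  (-1) ^ ((i : ℕ) + 1) * M.charpoly.coeff (2 - (i : ℕ))

/-- The Lax operator
`L(μ)_{ij} = γ_i δ_{ij} + ∑ s, φ_{is} ψ_{js} / (μ - λ_s)`. -/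
def laxMatrix {N : ℕ} (γ : Fin 3 → ℝ) (lam : Fin N → ℝ) (z : Phase N) (μ : ℝ) :
    Matrix (Fin 3) (Fin 3) ℝ :=
  Matrix.diagonal γ + Matrix.of fun i j => ∑ s, z.1 i s * z.2 j s / (μ - lam s)

/-- The expansion of the Lax operator at `μ = ∞`, as a matrix of formal power series in
`X = μ⁻¹`, from `1 / (μ - λ_s) = ∑ l, λ_s ^ l * μ ^ (-(l + 1))`. -/
def laxSeries {N : ℕ} (γ : Fin 3 → ℝ) (lam : Fin N → ℝ) (z : Phase N) :
    Matrix (Fin 3) (Fin 3) (PowerSeries ℝ) :=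
  Matrix.diagonal (fun i => PowerSeries.C (γ i)) + Matrix.of fun i j =>
    ∑ s, PowerSeries.C (z.1 i s * z.2 j s) *
      (PowerSeries.X * PowerSeries.mk fun l => lam s ^ l)

/-- `F γ lam i l` is the function `F_{i+1,l}` (`i = 0, 1, 2`, `l ≥ 0`): the coefficient of
`μ^{-l}` in the expansion of `𝓕_{i+1}(μ)` at `μ = ∞`. -/
def F {N : ℕ} (γ : Fin 3 → ℝ) (lam : Fin N → ℝ) (i : Fin 3) (l : ℕ) (z : Phase N) : ℝ :=
  PowerSeries.coeff l (charCoeff (laxSeries γ lam z) i)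

end MultiWave

end

/-! The factor `α i - α j` cancels in the temporal potential, so the temporal flow is the spatial
flow with `β` in place of `α`, and one flow suffices. With `x = 1/μ`, the Lax matrix becomes a
matrix of power series `L = Γ + ∑ e_s P_s`, where `P_s = φ^(s) ψ^(s)ᵀ` and `e_s` expands `1/(μ -
λ_s)`. The `F_{il}` are coefficients of conjugation invariants of `L`, and the gradient of each
invariant commutes with `L` (`commute_charGradient`).

Conservation: the constraint on the potential `U` says `[U, Γ] = -[A, ∑ P_s]` with `A = diag α`.
This turns the flow into the Lax equation `L' = [μA + U, L]` (`lax_commutator_identity`), so an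
invariant with gradient `G` has derivative `tr (G [μA + U, L]) = 0`.

Involution: in two independent variables `x`, `y`, the generating function of the brackets is `∑
e_s(x) e_s(y) tr ([K, G] P_s)`, with `G`, `K` the gradients at `L(x)`, `L(y)`. Partial fractions and
the two commutations make it vanish (`involution_identity`).

Independence: at `Φ = 1`, `Ψ = 0` the Jacobian in `ψ` is a Kronecker product of an invertible matrix
in `γ` and a Vandermonde matrix in `λ`. Its determinant is analytic, hence nonzero on a dense open
set. -/

noncomputable section

namespace MultiWave

/-! ### The characteristic coefficients of a `3 × 3` matrix and their gradients -/

section CharCoeff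

variable {R : Type} [CommRing R]

lemma charpoly_fin_three_eq (M : Matrix (Fin 3) (Fin 3) R) :
    M.charpoly = Polynomial.X ^ 3 - Polynomial.C (M 0 0 + M 1 1 + M 2 2) * Polynomial.X ^ 2 +
      Polynomial.C (M 0 0 * M 1 1 - M 0 1 * M 1 0 + (M 0 0 * M 2 2 - M 0 2 * M 2 0) +
        (M 1 1 * M 2 2 - M 1 2 * M 2 1)) * Polynomial.X - Polynomial.C M.det := by
  rw [Matrix.charpoly, Matrix.det_fin_three, Matrix.det_fin_three]
  simp only [Matrix.charmatrix_apply, Matrix.diagonal_apply, map_add, map_sub, map_mul]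
  simp
  ring

lemma charCoeff_zero (M : Matrix (Fin 3) (Fin 3) R) :
    charCoeff M 0 = M 0 0 + M 1 1 + M 2 2 := by
  simp only [charCoeff, charpoly_fin_three_eq]
  simp [Polynomial.coeff_X_pow, -map_add, -map_sub, -map_mul]

lemma charCoeff_one (M : Matrix (Fin 3) (Fin 3) R) :
    charCoeff M 1 = M 0 0 * M 1 1 - M 0 1 * M 1 0 + (M 0 0 * M 2 2 - M 0 2 * M 2 0) +
        (M 1 1 * M 2 2 - M 1 2 * M 2 1) := by
  simp only [charCoeff, charpoly_fin_three_eq]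
  simp [Polynomial.coeff_C, Polynomial.coeff_X_pow, -map_add, -map_sub, -map_mul]

lemma charCoeff_two (M : Matrix (Fin 3) (Fin 3) R) :
    charCoeff M 2 = M 0 0 * M 1 1 * M 2 2 - M 0 0 * M 1 2 * M 2 1 - M 0 1 * M 1 0 * M 2 2 +
      M 0 1 * M 1 2 * M 2 0 + M 0 2 * M 1 0 * M 2 1 - M 0 2 * M 1 1 * M 2 0 := by
  rw [← Matrix.det_fin_three]
  simp only [charCoeff, charpoly_fin_three_eq]
  simp [Polynomial.coeff_C, Polynomial.coeff_X_pow, -map_add, -map_sub, -map_mul]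
  ring

/-- The gradient of `charCoeff · i` at `M` with respect to the pairing `tr (A B)`. -/
def charGradient (M : Matrix (Fin 3) (Fin 3) R) : Fin 3 → Matrix (Fin 3) (Fin 3) R :=
  ![1, M.trace • (1 : Matrix (Fin 3) (Fin 3) R) - M, M.adjugate]

/-- The first two gradients are polynomials in `M`; for the adjugate, both products equal `det M •
1`. -/
lemma commute_charGradient (M : Matrix (Fin 3) (Fin 3) R) (i : Fin 3) :
    Commute (charGradient M i) M := by
  fin_cases i
  · exact Commute.one_left M
  · exact ((Commute.one_left M).smul_left _).sub_left (Commute.refl M)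
  · change M.adjugate * M = M * M.adjugate
    rw [Matrix.adjugate_mul, Matrix.mul_adjugate]

/-- By cyclicity the trace equals that of `K * (L * G - G * L)`. -/
lemma trace_mul_commutator_eq_zero {G L : Matrix (Fin 3) (Fin 3) R} (h : Commute G L)
    (K : Matrix (Fin 3) (Fin 3) R) : (G * (K * L - L * K)).trace = 0 := by
  rw [mul_sub, Matrix.trace_sub, ← mul_assoc, ← mul_assoc, Matrix.trace_mul_cycle,
    ← h.eq, sub_self]

end CharCoeff

/-! ### Curves of formal power series -/

section Curves

variable {E : Type*} [NormedAddCommGroup E] [NormedSpace ℝ E]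

/-- All coefficients of a family of power series are `C^n`. -/
def CoeffContDiff (n : WithTop ℕ∞) (f : E → PowerSeries ℝ) : Prop :=
  ∀ l, ContDiff ℝ n fun z => PowerSeries.coeff l (f z)

namespace CoeffContDiff

variable {n : WithTop ℕ∞} {f g : E → PowerSeries ℝ}

lemma add (hf : CoeffContDiff n f) (hg : CoeffContDiff n g) :
    CoeffContDiff n fun z => f z + g z := fun l => by
  simpa only [map_add] using (hf l).add (hg l)

lemma sub (hf : CoeffContDiff n f) (hg : CoeffContDiff n g) :
    CoeffContDiff n fun z => f z - g z := fun l => by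
  simpa only [map_sub] using (hf l).sub (hg l)

lemma mul (hf : CoeffContDiff n f) (hg : CoeffContDiff n g) :
    CoeffContDiff n fun z => f z * g z := fun l => by
  simp only [PowerSeries.coeff_mul]
  exact ContDiff.sum fun p _ => (hf p.1).mul (hg p.2)

lemma sum {ι : Type*} (s : Finset ι) {f : ι → E → PowerSeries ℝ}
    (hf : ∀ i ∈ s, CoeffContDiff n (f i)) : CoeffContDiff n fun z => ∑ i ∈ s, f i z := fun l => by
  simp only [map_sum]
  exact ContDiff.sum fun i hi => hf i hi l

lemma const (p : PowerSeries ℝ) : CoeffContDiff n fun _ : E => p := fun _ => contDiff_const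

lemma ofReal {c : E → ℝ} (hc : ContDiff ℝ n c) :
    CoeffContDiff n fun z => PowerSeries.C (c z) := fun l => by
  simp only [PowerSeries.coeff_C]
  split_ifs
  · exact hc
  · exact contDiff_const

lemma charCoeff {M : E → Matrix (Fin 3) (Fin 3) (PowerSeries ℝ)}
    (h : ∀ a b, CoeffContDiff n fun z => M z a b) (i : Fin 3) :
    CoeffContDiff n fun z => charCoeff (M z) i := by
  fin_cases i
  · simp only [Fin.zero_eta, charCoeff_zero]
    exact ((h _ _).add (h _ _)).add (h _ _)
  · simp only [Fin.mk_one, charCoeff_one]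
    exact ((((h _ _).mul (h _ _)).sub ((h _ _).mul (h _ _))).add
      (((h _ _).mul (h _ _)).sub ((h _ _).mul (h _ _)))).add
      (((h _ _).mul (h _ _)).sub ((h _ _).mul (h _ _)))
  · simp only [Fin.reduceFinMk, charCoeff_two]
    exact ((((((h _ _).mul (h _ _)).mul (h _ _)).sub (((h _ _).mul (h _ _)).mul (h _ _))).sub
      (((h _ _).mul (h _ _)).mul (h _ _))).add (((h _ _).mul (h _ _)).mul (h _ _))).add
      (((h _ _).mul (h _ _)).mul (h _ _)) |>.sub (((h _ _).mul (h _ _)).mul (h _ _))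

end CoeffContDiff

/-- The curve `f` of power series has the coefficientwise derivative `f'` at `t`. -/
def HasCoeffDerivAt (f : ℝ → PowerSeries ℝ) (f' : PowerSeries ℝ) (t : ℝ) : Prop :=
  ∀ l, HasDerivAt (fun τ => PowerSeries.coeff l (f τ)) (PowerSeries.coeff l f') t

namespace HasCoeffDerivAt

variable {f g : ℝ → PowerSeries ℝ} {f' g' : PowerSeries ℝ} {t : ℝ}

lemma add (hf : HasCoeffDerivAt f f' t) (hg : HasCoeffDerivAt g g' t) :
    HasCoeffDerivAt (fun τ => f τ + g τ) (f' + g') t := fun l => by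
  simpa only [map_add] using (hf l).fun_add (hg l)

lemma sub (hf : HasCoeffDerivAt f f' t) (hg : HasCoeffDerivAt g g' t) :
    HasCoeffDerivAt (fun τ => f τ - g τ) (f' - g') t := fun l => by
  simpa only [map_sub] using (hf l).fun_sub (hg l)

lemma mul (hf : HasCoeffDerivAt f f' t) (hg : HasCoeffDerivAt g g' t) :
    HasCoeffDerivAt (fun τ => f τ * g τ) (f' * g t + f t * g') t := fun l => by
  simp only [map_add, PowerSeries.coeff_mul, ← Finset.sum_add_distrib]
  exact HasDerivAt.fun_sum fun p _ => (hf p.1).fun_mul (hg p.2)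

lemma sum {ι : Type*} (s : Finset ι) {f : ι → ℝ → PowerSeries ℝ} {f' : ι → PowerSeries ℝ}
    (hf : ∀ i ∈ s, HasCoeffDerivAt (f i) (f' i) t) :
    HasCoeffDerivAt (fun τ => ∑ i ∈ s, f i τ) (∑ i ∈ s, f' i) t := fun l => by
  simp only [map_sum]
  exact HasDerivAt.fun_sum fun i hi => hf i hi l

lemma const (p : PowerSeries ℝ) (t : ℝ) : HasCoeffDerivAt (fun _ => p) 0 t := fun l => by
  simpa using hasDerivAt_const t (PowerSeries.coeff l p)

lemma ofReal {c : ℝ → ℝ} {c' : ℝ} (hc : HasDerivAt c c' t) :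
    HasCoeffDerivAt (fun τ => PowerSeries.C (c τ)) (PowerSeries.C c') t := fun l => by
  simp only [PowerSeries.coeff_C]
  split_ifs
  · exact hc
  · exact hasDerivAt_const t 0

/-- This is the product rule in the explicit polynomials; for the determinant it is Jacobi's
formula. -/
lemma charCoeff {M : ℝ → Matrix (Fin 3) (Fin 3) (PowerSeries ℝ)}
    {M' : Matrix (Fin 3) (Fin 3) (PowerSeries ℝ)}
    (h : ∀ a b, HasCoeffDerivAt (fun τ => M τ a b) (M' a b) t) (i : Fin 3) :
    HasCoeffDerivAt (fun τ => charCoeff (M τ) i) (charGradient (M t) i * M').trace t := by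
  fin_cases i
  · simp only [Fin.zero_eta, charCoeff_zero]
    convert ((h 0 0).add (h 1 1)).add (h 2 2) using 1
    simp [charGradient, Matrix.trace_fin_three]
  · simp only [Fin.mk_one, charCoeff_one]
    convert ((((h 0 0).mul (h 1 1)).sub ((h 0 1).mul (h 1 0))).add
      (((h 0 0).mul (h 2 2)).sub ((h 0 2).mul (h 2 0)))).add
      (((h 1 1).mul (h 2 2)).sub ((h 1 2).mul (h 2 1))) using 1
    simp [charGradient, Matrix.trace_fin_three, Matrix.mul_apply, Fin.sum_univ_three, sub_mul]
    ring
  · simp only [Fin.reduceFinMk, charCoeff_two]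
    convert ((((((h 0 0).mul (h 1 1)).mul (h 2 2)).sub (((h 0 0).mul (h 1 2)).mul (h 2 1))).sub
      (((h 0 1).mul (h 1 0)).mul (h 2 2))).add (((h 0 1).mul (h 1 2)).mul (h 2 0))).add
      (((h 0 2).mul (h 1 0)).mul (h 2 1)) |>.sub (((h 0 2).mul (h 1 1)).mul (h 2 0)) using 1
    simp [charGradient, Matrix.trace_fin_three, Matrix.vecMul, dotProduct, Fin.sum_univ_three,
      Matrix.adjugate_fin_three]
    ring

end HasCoeffDerivAt

/-- The power series `f` converges absolutely at `x` to `a`. -/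
def EvalsTo (x : ℝ) (f : PowerSeries ℝ) (a : ℝ) : Prop :=
  (Summable fun l => ‖PowerSeries.coeff l f * x ^ l‖) ∧
    HasSum (fun l => PowerSeries.coeff l f * x ^ l) a

namespace EvalsTo

variable {x : ℝ} {f g : PowerSeries ℝ} {a b : ℝ}

lemma add (hf : EvalsTo x f a) (hg : EvalsTo x g b) : EvalsTo x (f + g) (a + b) := by
  have h := hf.2.add hg.2
  simp only [← add_mul, ← map_add] at h
  exact ⟨h.summable.norm, h⟩

lemma sub (hf : EvalsTo x f a) (hg : EvalsTo x g b) : EvalsTo x (f - g) (a - b) := by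
  have h := hf.2.sub hg.2
  simp only [← sub_mul, ← map_sub] at h
  exact ⟨h.summable.norm, h⟩

lemma coeff_mul_mul_pow (f g : PowerSeries ℝ) (x : ℝ) (l : ℕ) :
    PowerSeries.coeff l (f * g) * x ^ l = ∑ p ∈ Finset.HasAntidiagonal.antidiagonal l,
      PowerSeries.coeff p.1 f * x ^ p.1 * (PowerSeries.coeff p.2 g * x ^ p.2) := by
  rw [PowerSeries.coeff_mul, Finset.sum_mul]
  refine Finset.sum_congr rfl fun p hp => ?_
  rw [← Finset.HasAntidiagonal.mem_antidiagonal.1 hp, pow_add]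
  ring

/-- Absolute convergence is what lets the Cauchy product converge to the product of the sums. -/
lemma mul (hf : EvalsTo x f a) (hg : EvalsTo x g b) : EvalsTo x (f * g) (a * b) := by
  have hs := summable_norm_sum_mul_antidiagonal_of_summable_norm hf.1 hg.1
  have ht := tsum_mul_tsum_eq_tsum_sum_antidiagonal_of_summable_norm hf.1 hg.1
  simp only [← coeff_mul_mul_pow] at hs ht
  refine ⟨hs, ?_⟩
  rw [← hf.2.tsum_eq, ← hg.2.tsum_eq, ht]
  exact hs.of_norm.hasSum

lemma const (x a : ℝ) : EvalsTo x (PowerSeries.C a) a := by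
  have h : HasSum (fun l => PowerSeries.coeff l (PowerSeries.C a) * x ^ l) a := by
    convert hasSum_ite_eq (0 : ℕ) a using 2 with l
    rw [PowerSeries.coeff_C]
    split_ifs with hl <;> simp [hl]
  exact ⟨h.summable.norm, h⟩

lemma sum {ι : Type*} (s : Finset ι) {f : ι → PowerSeries ℝ} {a : ι → ℝ}
    (hf : ∀ i ∈ s, EvalsTo x (f i) (a i)) : EvalsTo x (∑ i ∈ s, f i) (∑ i ∈ s, a i) := by
  have h := hasSum_sum fun i hi => (hf i hi).2
  simp only [← Finset.sum_mul, ← map_sum] at h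
  exact ⟨h.summable.norm, h⟩

lemma X (x : ℝ) : EvalsTo x PowerSeries.X x := by
  have h : HasSum (fun l => PowerSeries.coeff l (PowerSeries.X : PowerSeries ℝ) * x ^ l) x := by
    convert hasSum_ite_eq (1 : ℕ) x using 2 with l
    rw [PowerSeries.coeff_X]
    split_ifs with hl <;> simp [hl]
  exact ⟨h.summable.norm, h⟩

lemma geometric {c : ℝ} (h : |c * x| < 1) :
    EvalsTo x (PowerSeries.mk fun l => c ^ l) (1 - c * x)⁻¹ := by
  have hs : HasSum (fun l => PowerSeries.coeff l (PowerSeries.mk fun l => c ^ l) * x ^ l)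
      (1 - c * x)⁻¹ := by
    simpa only [PowerSeries.coeff_mk, ← mul_pow] using hasSum_geometric_of_abs_lt_one h
  exact ⟨hs.summable.norm, hs⟩

lemma charCoeff {M : Matrix (Fin 3) (Fin 3) (PowerSeries ℝ)} {A : Matrix (Fin 3) (Fin 3) ℝ}
    (h : ∀ a b, EvalsTo x (M a b) (A a b)) (i : Fin 3) :
    EvalsTo x (charCoeff M i) (charCoeff A i) := by
  fin_cases i
  · simp only [Fin.zero_eta, charCoeff_zero]
    exact ((h _ _).add (h _ _)).add (h _ _)
  · simp only [Fin.mk_one, charCoeff_one]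
    exact ((((h _ _).mul (h _ _)).sub ((h _ _).mul (h _ _))).add
      (((h _ _).mul (h _ _)).sub ((h _ _).mul (h _ _)))).add
      (((h _ _).mul (h _ _)).sub ((h _ _).mul (h _ _)))
  · simp only [Fin.reduceFinMk, charCoeff_two]
    exact ((((((h _ _).mul (h _ _)).mul (h _ _)).sub (((h _ _).mul (h _ _)).mul (h _ _))).sub
      (((h _ _).mul (h _ _)).mul (h _ _))).add (((h _ _).mul (h _ _)).mul (h _ _))).add
      (((h _ _).mul (h _ _)).mul (h _ _)) |>.sub (((h _ _).mul (h _ _)).mul (h _ _))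

end EvalsTo

end Curves

/-! ### Commutator identities behind the Lax equation and the involution -/

section Commutators

variable {R : Type} [CommRing R] {N : ℕ}

/-- This is `L' = [μA + U, L]` multiplied by `x = 1/μ`, which keeps it inside power series. By `he`,
the pole terms `x e_s c_s [A, P_s]` leave the remainder `-x ∑ [A, P_s]`, and `hU` identifies it with
`x [U, D]`. -/
lemma lax_commutator_identity (x : R) (e c : Fin N → R) (A U D : Matrix (Fin 3) (Fin 3) R)
    (P : Fin N → Matrix (Fin 3) (Fin 3) R) (he : ∀ s, x * (e s * c s) = e s - x)
    (hA : A * D = D * A) (hU : U * D - D * U = -∑ s, (A * P s - P s * A)) :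
    x • ∑ s, e s • ((c s • A + U) * P s - P s * (c s • A + U)) =
      (A + x • U) * (D + ∑ s, e s • P s) - (D + ∑ s, e s • P s) * (A + x • U) := by
  have hR : (A + x • U) * (D + ∑ s, e s • P s) - (D + ∑ s, e s • P s) * (A + x • U) =
      (A * D - D * A) + x • (U * D - D * U) +
        ∑ s, (e s • (A * P s - P s * A) + x • e s • (U * P s - P s * U)) := by
    simp only [add_mul, mul_add, smul_add, Finset.mul_sum, Finset.sum_mul, smul_mul_assoc,
      mul_smul_comm, smul_sub, Finset.sum_sub_distrib, Finset.sum_add_distrib, Finset.smul_sum,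
      smul_smul, mul_comm x]
    abel
  rw [hR, hA, hU, sub_self, zero_add, smul_neg, Finset.smul_sum, Finset.smul_sum,
    ← Finset.sum_neg_distrib, ← Finset.sum_add_distrib]
  refine Finset.sum_congr rfl fun s _ => ?_
  have h1 : (c s • A + U) * P s - P s * (c s • A + U) =
      c s • (A * P s - P s * A) + (U * P s - P s * U) := by
    simp only [add_mul, mul_add, smul_mul_assoc, mul_smul_comm, smul_sub]
    abel
  rw [h1, smul_add, smul_add, ← add_assoc, smul_smul, smul_smul, mul_assoc, he, sub_smul]
  abel

/-- The hypothesis `hef` is the partial fraction decomposition of `1/((μ - λ)(μ' - λ))` for `x =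
1/μ`, `y = 1/μ'`. It reduces the sum to the difference of `tr ([K, G] ∑ e_s P_s)` and `tr ([K, G] ∑
f_s P_s)`; by the two commutations both equal `-tr ([K, G] D)`. -/
lemma involution_identity (x y : R) (e f : Fin N → R) (D G K : Matrix (Fin 3) (Fin 3) R)
    (φ ψ : Fin N → Fin 3 → R)
    (hef : ∀ s, (x - y) * (e s * f s) = x * y * (e s - f s))
    (hG : Commute G (D + ∑ s, e s • Matrix.vecMulVec (φ s) (ψ s)))
    (hK : Commute K (D + ∑ s, f s • Matrix.vecMulVec (φ s) (ψ s))) :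
    (x - y) * ∑ a, ∑ s, ((G *ᵥ φ s) a * e s * ((ψ s ᵥ* K) a * f s) -
      (ψ s ᵥ* G) a * e s * ((K *ᵥ φ s) a * f s)) = 0 := by
  have h1 : ∀ s, ∑ a, ((G *ᵥ φ s) a * e s * ((ψ s ᵥ* K) a * f s) -
      (ψ s ᵥ* G) a * e s * ((K *ᵥ φ s) a * f s)) =
      e s * f s * ((K * G - G * K) * Matrix.vecMulVec (φ s) (ψ s)).trace := by
    intro s
    have h2 : ((K * G - G * K) * Matrix.vecMulVec (φ s) (ψ s)).trace =
        ψ s ᵥ* K ⬝ᵥ (G *ᵥ φ s) - ψ s ᵥ* G ⬝ᵥ (K *ᵥ φ s) := by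
      have h : ∀ A B : Matrix (Fin 3) (Fin 3) R,
          (A *ᵥ (B *ᵥ φ s)) ⬝ᵥ ψ s = ψ s ᵥ* A ⬝ᵥ (B *ᵥ φ s) := fun A B => by
        rw [dotProduct_comm, Matrix.dotProduct_mulVec]
      rw [Matrix.mul_vecMulVec, Matrix.trace_vecMulVec, Matrix.sub_mulVec, sub_dotProduct,
        ← Matrix.mulVec_mulVec, ← Matrix.mulVec_mulVec, h, h]
    rw [h2]
    simp only [dotProduct, ← Finset.sum_sub_distrib, Finset.mul_sum]
    exact Finset.sum_congr rfl fun a _ => by ring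
  rw [Finset.sum_comm, Finset.sum_congr rfl fun s _ => h1 s, Finset.mul_sum]
  have h3 : ∀ s, (x - y) * (e s * f s * ((K * G - G * K) *
      Matrix.vecMulVec (φ s) (ψ s)).trace) = x * y * (((K * G - G * K) *
        (e s • Matrix.vecMulVec (φ s) (ψ s))).trace - ((K * G - G * K) *
        (f s • Matrix.vecMulVec (φ s) (ψ s))).trace) := by
    intro s
    rw [← mul_assoc, hef, mul_smul_comm, mul_smul_comm, Matrix.trace_smul, Matrix.trace_smul,
      smul_eq_mul, smul_eq_mul]
    ring
  rw [Finset.sum_congr rfl fun s _ => h3 s, ← Finset.mul_sum, Finset.sum_sub_distrib,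
    ← Matrix.trace_sum, ← Matrix.trace_sum, ← Finset.mul_sum, ← Finset.mul_sum]
  have h4 : ((K * G - G * K) * (D + ∑ s, e s • Matrix.vecMulVec (φ s) (ψ s))).trace = 0 := by
    rw [sub_mul, Matrix.trace_sub, mul_assoc, hG.eq, Matrix.trace_mul_cycle', ← mul_assoc,
      sub_self]
  have h5 : ((K * G - G * K) * (D + ∑ s, f s • Matrix.vecMulVec (φ s) (ψ s))).trace = 0 := by
    rw [sub_mul, Matrix.trace_sub, mul_assoc K, mul_assoc G, hK.eq, Matrix.trace_mul_comm K,
      mul_assoc, sub_self]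
  rw [mul_add, Matrix.trace_add] at h4 h5
  linear_combination x * y * (h4 - h5)

end Commutators

/-! ### The expansion of the Lax operator -/

/-- The expansion of `1 / (μ - c)` at `μ = ∞`. -/
def poleSeries (c : ℝ) : PowerSeries ℝ := PowerSeries.X * PowerSeries.mk fun l => c ^ l

lemma coeff_succ_poleSeries (c : ℝ) (l : ℕ) : PowerSeries.coeff (l + 1) (poleSeries c) = c ^ l := by
  rw [poleSeries, PowerSeries.coeff_succ_X_mul, PowerSeries.coeff_mk]

/-- The expansion of `c/(μ - c) = μ/(μ - c) - 1`, multiplied by `1/μ`. -/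
lemma poleSeries_mul (c : ℝ) :
    PowerSeries.X * (poleSeries c * PowerSeries.C c) = poleSeries c - PowerSeries.X := by
  ext l
  rcases l with _ | _ | l
  · simp [poleSeries]
  · rw [PowerSeries.coeff_succ_X_mul, PowerSeries.coeff_mul_C, map_sub, coeff_succ_poleSeries]
    simp [poleSeries]
  · rw [PowerSeries.coeff_succ_X_mul, PowerSeries.coeff_mul_C, map_sub, coeff_succ_poleSeries,
      coeff_succ_poleSeries, PowerSeries.coeff_X]
    simp [pow_succ]

lemma evalsTo_poleSeries {c μ : ℝ} (h : |c| < |μ|) :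
    EvalsTo μ⁻¹ (poleSeries c) (1 / (μ - c)) := by
  have hμ : μ ≠ 0 := abs_pos.1 ((abs_nonneg c).trans_lt h)
  have hc : |c * μ⁻¹| < 1 := by
    rw [abs_mul, abs_inv, ← div_eq_mul_inv, div_lt_one (abs_pos.2 hμ)]
    exact h
  have hne : μ - c ≠ 0 := fun h0 => by
    rw [sub_eq_zero.1 h0] at h
    exact lt_irrefl _ h
  have h1 : 1 / (μ - c) = μ⁻¹ * (1 - c * μ⁻¹)⁻¹ := by
    rw [← mul_inv, mul_sub, one_div]
    congr 1
    field_simp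
  rw [h1]
  exact (EvalsTo.X μ⁻¹).mul (EvalsTo.geometric hc)

variable {N : ℕ} (γ : Fin 3 → ℝ) (lam : Fin N → ℝ)

lemma laxSeries_apply (z : Phase N) (i j : Fin 3) :
    laxSeries γ lam z i j = PowerSeries.C (Matrix.diagonal γ i j) +
      ∑ s, PowerSeries.C (z.1 i s * z.2 j s) * poleSeries (lam s) := by
  rw [laxSeries, Matrix.add_apply, Matrix.of_apply]
  congr 1
  rw [Matrix.diagonal_apply, Matrix.diagonal_apply]
  split_ifs <;> simp

lemma laxSeries_eq (z : Phase N) :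
    laxSeries γ lam z = (Matrix.diagonal γ).map PowerSeries.C +
      ∑ s, poleSeries (lam s) • Matrix.vecMulVec (fun a => PowerSeries.C (z.1 a s))
        (fun a => PowerSeries.C (z.2 a s)) := by
  ext i j : 1
  rw [laxSeries_apply, Matrix.add_apply, Matrix.map_apply, Matrix.sum_apply]
  refine congrArg (PowerSeries.C (Matrix.diagonal γ i j) + ·)
    (Finset.sum_congr rfl fun s _ => ?_)
  rw [Matrix.smul_apply, Matrix.vecMulVec_apply, smul_eq_mul, map_mul, mul_comm]

theorem hasSum_F {z : Phase N} {μ : ℝ} (hμ : ∀ s, |lam s| < |μ|) (i : Fin 3) :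
    HasSum (fun l => F γ lam i l z * μ⁻¹ ^ l) (charCoeff (laxMatrix γ lam z μ) i) := by
  refine (EvalsTo.charCoeff (fun a b => ?_) i).2
  rw [laxSeries_apply, laxMatrix, Matrix.add_apply, Matrix.of_apply]
  refine (EvalsTo.const _ _).add (EvalsTo.sum _ fun s _ => ?_)
  convert (EvalsTo.const _ _).mul (evalsTo_poleSeries (hμ s)) using 1
  rw [mul_one_div]

theorem contDiff_F (n : WithTop ℕ∞) (i : Fin 3) (l : ℕ) : ContDiff ℝ n (F γ lam i l) := by
  refine CoeffContDiff.charCoeff (fun a b => ?_) i l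
  simp only [laxSeries_apply]
  refine (CoeffContDiff.const _).add (CoeffContDiff.sum _ fun s _ =>
    (CoeffContDiff.ofReal ?_).mul (CoeffContDiff.const _))
  fun_prop

/-- The directional derivative of the Lax series at `z` along `v`. -/
def laxSeriesDeriv (z v : Phase N) : Matrix (Fin 3) (Fin 3) (PowerSeries ℝ) :=
  Matrix.of fun i j => ∑ s, PowerSeries.C (v.1 i s * z.2 j s + z.1 i s * v.2 j s) *
    poleSeries (lam s)

lemma hasDerivAt_F {c : ℝ → Phase N} {v : Phase N} {t : ℝ} (hc : HasDerivAt c v t)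
    (i : Fin 3) (l : ℕ) :
    HasDerivAt (fun τ => F γ lam i l (c τ))
      (PowerSeries.coeff l
        (charGradient (laxSeries γ lam (c t)) i * laxSeriesDeriv lam (c t) v).trace) t := by
  refine HasCoeffDerivAt.charCoeff (fun a b => ?_) i l
  have h1 : ∀ a s, HasDerivAt (fun τ => (c τ).1 a s) (v.1 a s) t := fun a s =>
    hasDerivAt_pi.1 (hasDerivAt_pi.1 (hasFDerivAt_fst.comp_hasDerivAt t hc) a) s
  have h2 : ∀ a s, HasDerivAt (fun τ => (c τ).2 a s) (v.2 a s) t := fun a s =>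
    hasDerivAt_pi.1 (hasDerivAt_pi.1 (hasFDerivAt_snd.comp_hasDerivAt t hc) a) s
  simp only [laxSeries_apply]
  have h := (HasCoeffDerivAt.const (PowerSeries.C (Matrix.diagonal γ a b)) t).add
    (HasCoeffDerivAt.sum Finset.univ fun s _ =>
      (HasCoeffDerivAt.ofReal ((h1 a s).fun_mul (h2 b s))).mul
        (HasCoeffDerivAt.const (poleSeries (lam s)) t))
  simpa only [laxSeriesDeriv, Matrix.of_apply, zero_add, mul_zero, add_zero] using h

lemma fderiv_F (i : Fin 3) (l : ℕ) (z v : Phase N) :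
    fderiv ℝ (F γ lam i l) z v =
      PowerSeries.coeff l (charGradient (laxSeries γ lam z) i * laxSeriesDeriv lam z v).trace := by
  have hc : HasDerivAt (fun t : ℝ => z + t • v) v 0 := by
    simpa using ((hasDerivAt_id (0 : ℝ)).smul_const v).const_add z
  have h1 := hasDerivAt_F γ lam hc i l
  have h2 : HasFDerivAt (F γ lam i l) (fderiv ℝ (F γ lam i l) z) z :=
    ((contDiff_F γ lam 1 i l).differentiable one_ne_zero z).hasFDerivAt
  have h3 : HasDerivAt (fun t : ℝ => F γ lam i l (z + t • v)) (fderiv ℝ (F γ lam i l) z v) 0 :=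
    h2.comp_hasDerivAt_of_eq (0 : ℝ) hc (by simp)
  simpa using h3.unique h1

lemma dPsi_F (i : Fin 3) (l : ℕ) (z : Phase N) (a : Fin 3) (s : Fin N) :
    dPsi (F γ lam i l) z a s = PowerSeries.coeff l
      ((charGradient (laxSeries γ lam z) i *ᵥ fun b => PowerSeries.C (z.1 b s)) a *
        poleSeries (lam s)) := by
  -- Moving a single `ψ_{as}` changes the Lax series by a rank-one matrix, so the trace collapses to
  -- one entry.
  have h : laxSeriesDeriv lam z (0, Pi.single a (Pi.single s 1)) =
      Matrix.vecMulVec (fun b => PowerSeries.C (z.1 b s)) (Pi.single a (poleSeries (lam s))) := by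
    ext b d : 1
    rw [laxSeriesDeriv, Matrix.of_apply, Matrix.vecMulVec_apply, Finset.sum_eq_single s]
    · rcases eq_or_ne d a with rfl | hd
      · simp
      · simp [hd]
    · intro r _ hr
      rcases eq_or_ne d a with rfl | hd
      · simp [hr]
      · simp [hd]
    · simp
  rw [dPsi, fderiv_F, h, Matrix.mul_vecMulVec, Matrix.trace_vecMulVec, dotProduct_single]

lemma dPhi_F (i : Fin 3) (l : ℕ) (z : Phase N) (a : Fin 3) (s : Fin N) :
    dPhi (F γ lam i l) z a s = PowerSeries.coeff l
      (((fun b => PowerSeries.C (z.2 b s)) ᵥ* charGradient (laxSeries γ lam z) i) a *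
        poleSeries (lam s)) := by
  have h : laxSeriesDeriv lam z (Pi.single a (Pi.single s 1), 0) =
      Matrix.vecMulVec (Pi.single a (poleSeries (lam s))) (fun b => PowerSeries.C (z.2 b s)) := by
    ext b d : 1
    rw [laxSeriesDeriv, Matrix.of_apply, Matrix.vecMulVec_apply, Finset.sum_eq_single s]
    · rcases eq_or_ne b a with rfl | hd
      · simp [mul_comm]
      · simp [hd]
    · intro r _ hr
      rcases eq_or_ne b a with rfl | hd
      · simp [hr]
      · simp [hd]
    · simp
  rw [dPhi, fderiv_F, h, Matrix.trace_mul_comm, Matrix.vecMulVec_mul, Matrix.trace_vecMulVec,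
    single_dotProduct, mul_comm]

/-! ### Involution -/

lemma map_charGradient_commute {S : Type} [CommRing S] (f : PowerSeries ℝ →+* S) (z : Phase N)
    (i : Fin 3) :
    Commute ((charGradient (laxSeries γ lam z) i).map f)
      ((Matrix.diagonal γ).map (fun c => f (PowerSeries.C c)) +
        ∑ s, f (poleSeries (lam s)) • Matrix.vecMulVec (fun a => f (PowerSeries.C (z.1 a s)))
          (fun a => f (PowerSeries.C (z.2 a s)))) := by
  have h := (commute_charGradient (laxSeries γ lam z) i).map f.mapMatrix
  have h2 : f.mapMatrix (laxSeries γ lam z) =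
      (Matrix.diagonal γ).map (fun c => f (PowerSeries.C c)) +
        ∑ s, f (poleSeries (lam s)) • Matrix.vecMulVec (fun a => f (PowerSeries.C (z.1 a s)))
          (fun a => f (PowerSeries.C (z.2 a s))) := by
    rw [laxSeries_eq, map_add, map_sum]
    refine congrArg₂ (· + ·) ?_ (Finset.sum_congr rfl fun s _ => ?_)
    · ext a b : 1
      simp only [RingHom.mapMatrix_apply, Matrix.map_apply]
    · ext a b : 1
      simp [Matrix.vecMulVec_apply]
  rw [h2] at h
  exact h

/-- Placing one factor in the inner variable and the other in the outer one makes each product of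
coefficients a coefficient of a product, so a single identity covers all `l` and `k`. -/
lemma coeff_coeff_C_mul_map (f g : PowerSeries ℝ) (l k : ℕ) :
    PowerSeries.coeff l (PowerSeries.coeff k
      (PowerSeries.C f * PowerSeries.map PowerSeries.C g)) =
      PowerSeries.coeff l f * PowerSeries.coeff k g := by
  rw [PowerSeries.coeff_C_mul, PowerSeries.coeff_map, PowerSeries.coeff_mul_C]

lemma poleSeries_mul_poleSeries (c : ℝ) :
    (PowerSeries.C PowerSeries.X - PowerSeries.X : PowerSeries (PowerSeries ℝ)) *
      (PowerSeries.C (poleSeries c) * PowerSeries.map PowerSeries.C (poleSeries c)) =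
    PowerSeries.C PowerSeries.X * PowerSeries.X *
      (PowerSeries.C (poleSeries c) - PowerSeries.map PowerSeries.C (poleSeries c)) := by
  have h1 := congrArg (PowerSeries.C (R := PowerSeries ℝ)) (poleSeries_mul c)
  have h2 := congrArg (PowerSeries.map (PowerSeries.C (R := ℝ))) (poleSeries_mul c)
  simp only [map_mul, map_sub, PowerSeries.map_X, PowerSeries.map_C] at h1 h2
  linear_combination
    PowerSeries.map PowerSeries.C (poleSeries c) * PowerSeries.X * h1 -
    PowerSeries.C (poleSeries c) * PowerSeries.C PowerSeries.X * h2

theorem poisson_F_F (i j : Fin 3) (l k : ℕ) (z : Phase N) :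
    poisson (F γ lam i l) (F γ lam j k) z = 0 := by
  set ι : PowerSeries ℝ →+* PowerSeries (PowerSeries ℝ) := PowerSeries.C with hι
  set κ : PowerSeries ℝ →+* PowerSeries (PowerSeries ℝ) := PowerSeries.map PowerSeries.C with hκ
  have hικ : ∀ c : ℝ, ι (PowerSeries.C c) = κ (PowerSeries.C c) := fun c => by
    simp [hι, hκ]
  have hG := map_charGradient_commute γ lam ι z i
  have hK := map_charGradient_commute γ lam κ z j
  -- Constants embed equally through `ι` and `κ`, so both commutations share the same `D`, `φ` and
  -- `ψ`.
  simp only [← hικ] at hK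
  have h := involution_identity _ _ _ _ _ _ _ _ _
    (fun s => poleSeries_mul_poleSeries (lam s)) hG hK
  have hne : (PowerSeries.C PowerSeries.X - PowerSeries.X : PowerSeries (PowerSeries ℝ)) ≠ 0 := by
    intro h0
    have h1 := congrArg (PowerSeries.coeff 1) h0
    simp at h1
  -- Iterated power series over `ℝ` form a domain, so `x - y` cancels.
  have hB := (mul_eq_zero.1 h).resolve_left hne
  have hmul : ∀ (f : PowerSeries ℝ →+* PowerSeries (PowerSeries ℝ))
      (A : Matrix (Fin 3) (Fin 3) (PowerSeries ℝ)) (w : Fin 3 → PowerSeries ℝ) (a : Fin 3),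
      (A.map f *ᵥ fun b => f (w b)) a = f ((A *ᵥ w) a) := fun f A w a => by
    simp [Matrix.mulVec, dotProduct]
  have hvec : ∀ (f : PowerSeries ℝ →+* PowerSeries (PowerSeries ℝ))
      (A : Matrix (Fin 3) (Fin 3) (PowerSeries ℝ)) (w : Fin 3 → PowerSeries ℝ) (a : Fin 3),
      ((fun b => f (w b)) ᵥ* A.map f) a = f ((w ᵥ* A) a) := fun f A w a => by
    simp [Matrix.vecMul, dotProduct]
  have hterm : poisson (F γ lam i l) (F γ lam j k) z = PowerSeries.coeff l (PowerSeries.coeff k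
      (∑ a, ∑ s, (ι ((charGradient (laxSeries γ lam z) i *ᵥ fun b => PowerSeries.C (z.1 b s)) a) *
          ι (poleSeries (lam s)) *
        (κ (((fun b => PowerSeries.C (z.2 b s)) ᵥ* charGradient (laxSeries γ lam z) j) a) *
          κ (poleSeries (lam s))) -
        ι (((fun b => PowerSeries.C (z.2 b s)) ᵥ* charGradient (laxSeries γ lam z) i) a) *
          ι (poleSeries (lam s)) *
        (κ ((charGradient (laxSeries γ lam z) j *ᵥ fun b => PowerSeries.C (z.1 b s)) a) *
          κ (poleSeries (lam s)))))) := by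
    simp only [poisson, dotProduct, map_sum, map_sub, ← map_mul, ← Finset.sum_sub_distrib]
    simp only [hι, hκ, coeff_coeff_C_mul_map, dPsi_F, dPhi_F]
  rw [hterm]
  simp only [← hmul, ← hvec]
  simp only [hικ] at hB ⊢
  rw [hB, map_zero, map_zero]

/-! ### The flows: Lax equation, integrals of motion, Hamiltonians -/

variable (α β : Fin 3 → ℝ)

lemma temporalFlow_eq_spatialFlow (hα : Function.Injective α) :
    temporalFlow α β γ lam = spatialFlow β γ lam := by
  have h : ∀ (z : Phase N) (μ : ℝ), matV α β (constrainedPotential α γ z) μ =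
      matU β (constrainedPotential β γ z) μ := by
    intro z μ
    ext i j
    simp only [matV, matU, spectralMatrix, Matrix.of_apply, constrainedPotential]
    split_ifs with hij
    · rfl
    · have : α i - α j ≠ 0 := sub_ne_zero.2 fun h => hij (hα h)
      rw [← mul_assoc, div_mul_div_comm, mul_comm (α i - α j), mul_div_mul_right _ _ this]
  rw [temporalFlow, spatialFlow]
  congr 1
  funext z μ
  exact h z μ

/-- The matrix of the constrained potentials; its diagonal vanishes. -/
def potentialMatrix (z : Phase N) : Matrix (Fin 3) (Fin 3) ℝ :=
  Matrix.of (constrainedPotential α γ z)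

lemma matU_eq (z : Phase N) (μ : ℝ) :
    matU α (constrainedPotential α γ z) μ =
      μ • Matrix.diagonal α + potentialMatrix γ α z := by
  ext i j
  simp only [matU, spectralMatrix, potentialMatrix, Matrix.of_apply, Matrix.add_apply,
    Matrix.smul_apply, Matrix.diagonal_apply]
  split_ifs with h
  · subst h
    -- The diagonal coefficient is `0 / 0`, which is `0`.
    simp [constrainedPotential, mul_comm]
  · simp

/-- Entrywise, commuting with `diagonal γ` multiplies by `γ j - γ i`, which cancels the denominator
of the potential. -/
lemma potentialMatrix_commutator (hγ : Function.Injective γ) (z : Phase N) :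
    potentialMatrix γ α z * Matrix.diagonal γ - Matrix.diagonal γ * potentialMatrix γ α z =
      -∑ s, (Matrix.diagonal α * Matrix.vecMulVec (fun a => z.1 a s) (fun a => z.2 a s) -
        Matrix.vecMulVec (fun a => z.1 a s) (fun a => z.2 a s) * Matrix.diagonal α) := by
  ext i j
  simp only [Matrix.sub_apply, Matrix.neg_apply, Matrix.sum_apply, Matrix.mul_diagonal,
    Matrix.diagonal_mul, Matrix.vecMulVec_apply, potentialMatrix, Matrix.of_apply]
  by_cases h : i = j
  · subst h
    simp [mul_comm]
  · have hne : γ i - γ j ≠ 0 := sub_ne_zero.2 fun h' => h (hγ h')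
    have h1 : ∑ s, (α i * (z.1 i s * z.2 j s) - z.1 i s * z.2 j s * α j) =
        (α i - α j) * (z.1 i ⬝ᵥ z.2 j) := by
      rw [dotProduct, Finset.mul_sum]
      exact Finset.sum_congr rfl fun s _ => by ring
    rw [h1, constrainedPotential]
    field_simp
    ring

/-- If `φ' = M φ` and `ψ' = -Mᵀ ψ`, then `(φ ψᵀ)' = [M, φ ψᵀ]`. -/
lemma laxSeriesDeriv_spatialFlow (z : Phase N) :
    laxSeriesDeriv lam z (spatialFlow α γ lam z) = ∑ s, poleSeries (lam s) •
      (((PowerSeries.C (lam s) • (Matrix.diagonal α).map PowerSeries.C +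
          (potentialMatrix γ α z).map PowerSeries.C) *
        Matrix.vecMulVec (fun a => PowerSeries.C (z.1 a s)) (fun a => PowerSeries.C (z.2 a s)) -
        Matrix.vecMulVec (fun a => PowerSeries.C (z.1 a s)) (fun a => PowerSeries.C (z.2 a s)) *
        (PowerSeries.C (lam s) • (Matrix.diagonal α).map PowerSeries.C +
          (potentialMatrix γ α z).map PowerSeries.C) :
            Matrix (Fin 3) (Fin 3) (PowerSeries ℝ))) := by
  ext i j : 1
  rw [laxSeriesDeriv, Matrix.of_apply, Matrix.sum_apply]
  refine Finset.sum_congr rfl fun s _ => ?_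
  have h1 : ((lam s • Matrix.diagonal α + potentialMatrix γ α z).map PowerSeries.C :
      Matrix (Fin 3) (Fin 3) (PowerSeries ℝ)) =
      PowerSeries.C (lam s) • (Matrix.diagonal α).map PowerSeries.C +
        (potentialMatrix γ α z).map PowerSeries.C := by
    ext a b : 1
    simp only [Matrix.map_apply, Matrix.add_apply, Matrix.smul_apply, map_add, map_mul, smul_eq_mul]
  rw [← h1, Matrix.smul_apply, Matrix.sub_apply, Matrix.mul_vecMulVec, Matrix.vecMulVec_mul,
    Matrix.vecMulVec_apply, Matrix.vecMulVec_apply, smul_eq_mul, mul_comm]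
  congr 1
  simp only [spatialFlow, binaryField, matU_eq, Matrix.neg_mulVec, Matrix.mulVec_transpose]
  simp only [Matrix.mulVec, Matrix.vecMul, dotProduct, Pi.neg_apply, Matrix.map_apply, map_add,
    map_mul, map_sum, map_neg]
  ring

theorem trace_charGradient_mul_laxSeriesDeriv_spatialFlow (hγ : Function.Injective γ)
    (z : Phase N) (i : Fin 3) :
    (charGradient (laxSeries γ lam z) i *
      laxSeriesDeriv lam z (spatialFlow α γ lam z)).trace = 0 := by
  have hA : (Matrix.diagonal α).map PowerSeries.C * (Matrix.diagonal γ).map PowerSeries.C =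
      ((Matrix.diagonal γ).map PowerSeries.C * (Matrix.diagonal α).map PowerSeries.C :
        Matrix (Fin 3) (Fin 3) (PowerSeries ℝ)) := by
    rw [← Matrix.map_mul, ← Matrix.map_mul, Matrix.diagonal_mul_diagonal,
      Matrix.diagonal_mul_diagonal]
    simp only [mul_comm]
  have hU := congrArg (PowerSeries.C (R := ℝ)).mapMatrix (potentialMatrix_commutator γ α hγ z)
  have hP : ∀ s, (PowerSeries.C (R := ℝ)).mapMatrix
      (Matrix.vecMulVec (fun a => z.1 a s) (fun a => z.2 a s)) =
      Matrix.vecMulVec (fun a => PowerSeries.C (z.1 a s)) (fun a => PowerSeries.C (z.2 a s)) := by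
    intro s
    ext a b : 1
    simp [Matrix.vecMulVec_apply]
  simp only [map_sub, map_neg, map_sum, map_mul, hP, RingHom.mapMatrix_apply] at hU
  have h := lax_commutator_identity PowerSeries.X (fun s => poleSeries (lam s))
    (fun s => PowerSeries.C (lam s)) _ _ _ _ (fun s => poleSeries_mul (lam s)) hA hU
  rw [← laxSeriesDeriv_spatialFlow, ← laxSeries_eq] at h
  have h2 := trace_mul_commutator_eq_zero (commute_charGradient (laxSeries γ lam z) i)
    ((Matrix.diagonal α).map PowerSeries.C +
      (PowerSeries.X : PowerSeries ℝ) • (potentialMatrix γ α z).map PowerSeries.C)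
  rw [← h, mul_smul_comm, Matrix.trace_smul, smul_eq_mul] at h2
  exact (mul_eq_zero.1 h2).resolve_left PowerSeries.X_ne_zero

theorem isIntegralOfMotion_F (hγ : Function.Injective γ) (i : Fin 3) (l : ℕ) :
    IsIntegralOfMotion (spatialFlow α γ lam) (F γ lam i l) := by
  intro a b c hc t ht t' ht'
  have hd : ∀ τ ∈ Set.Ioo a b, HasDerivAt (fun τ => F γ lam i l (c τ)) 0 τ := by
    intro τ hτ
    have h := hasDerivAt_F γ lam (hc τ hτ) i l
    rwa [trace_charGradient_mul_laxSeriesDeriv_spatialFlow γ lam α hγ, map_zero] at h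
  exact isOpen_Ioo.is_const_of_deriv_eq_zero isPreconnected_Ioo
    (fun τ hτ => (hd τ hτ).differentiableAt.differentiableWithinAt)
    (fun τ hτ => (hd τ hτ).deriv) ht ht'

/-- The Hamiltonian of the spatial constrained flow. -/
def spatialHamiltonian (z : Phase N) : ℝ :=
  -(∑ i, ∑ s, α i * lam s * (z.1 i s * z.2 i s) +
    2⁻¹ * ∑ i, ∑ j, (α i - α j) / (γ i - γ j) *
      ((∑ s, z.1 i s * z.2 j s) * ∑ s, z.1 j s * z.2 i s))

lemma contDiff_spatialHamiltonian : ContDiff ℝ ∞ (spatialHamiltonian γ lam α) := by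
  unfold spatialHamiltonian
  fun_prop

/-- The two factors of the quartic term of the Hamiltonian contribute equally to its derivative,
which absorbs the factor `1/2`. -/
lemma half_sum_symmetric {c : Fin 3 → Fin 3 → ℝ} (hc : ∀ i j, c i j = c j i)
    (p d : Fin 3 → Fin 3 → ℝ) :
    2⁻¹ * ∑ i, ∑ j, c i j * (d i j * p j i + p i j * d j i) =
      ∑ i, ∑ j, c i j * (p i j * d j i) := by
  have h : ∑ i, ∑ j, c i j * (d i j * p j i) = ∑ i, ∑ j, c i j * (p i j * d j i) := by
    rw [Finset.sum_comm]
    exact Finset.sum_congr rfl fun i _ => Finset.sum_congr rfl fun j _ => by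
      rw [hc j i, mul_comm (d j i)]
  simp only [mul_add (c _ _), Finset.sum_add_distrib, h]
  ring

lemma fderiv_spatialHamiltonian (z v : Phase N) :
    fderiv ℝ (spatialHamiltonian γ lam α) z v =
      -(∑ i, ∑ s, α i * lam s * (v.1 i s * z.2 i s + z.1 i s * v.2 i s) +
        ∑ i, ∑ j, (α i - α j) / (γ i - γ j) *
          ((∑ s, z.1 i s * z.2 j s) * ∑ s, (v.1 j s * z.2 i s + z.1 j s * v.2 i s))) := by
  have hc : HasDerivAt (fun t : ℝ => z + t • v) v 0 := by
    simpa using ((hasDerivAt_id (0 : ℝ)).smul_const v).const_add z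
  have hH : HasFDerivAt (spatialHamiltonian γ lam α)
      (fderiv ℝ (spatialHamiltonian γ lam α) z) z :=
    ((contDiff_spatialHamiltonian γ lam α).differentiable (by simp) z).hasFDerivAt
  have h1 : HasDerivAt (fun t : ℝ => spatialHamiltonian γ lam α (z + t • v))
      (fderiv ℝ (spatialHamiltonian γ lam α) z v) 0 :=
    hH.comp_hasDerivAt_of_eq (0 : ℝ) hc (by simp)
  have hp : ∀ i j s, HasDerivAt (fun t : ℝ => (z + t • v).1 i s * (z + t • v).2 j s)
      (v.1 i s * z.2 j s + z.1 i s * v.2 j s) 0 := by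
    intro i j s
    have h1 : HasDerivAt (fun t : ℝ => (z + t • v).1 i s) (v.1 i s) 0 :=
      hasDerivAt_pi.1 (hasDerivAt_pi.1 (hasFDerivAt_fst.comp_hasDerivAt (0 : ℝ) hc) i) s
    have h2 : HasDerivAt (fun t : ℝ => (z + t • v).2 j s) (v.2 j s) 0 :=
      hasDerivAt_pi.1 (hasDerivAt_pi.1 (hasFDerivAt_snd.comp_hasDerivAt (0 : ℝ) hc) j) s
    simpa using h1.fun_mul h2
  have hq : ∀ i j, HasDerivAt (fun t : ℝ => ∑ s, (z + t • v).1 i s * (z + t • v).2 j s)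
      (∑ s, (v.1 i s * z.2 j s + z.1 i s * v.2 j s)) 0 := fun i j =>
    HasDerivAt.fun_sum fun s _ => hp i j s
  have h2 := ((HasDerivAt.fun_sum fun i (_ : i ∈ Finset.univ) =>
    HasDerivAt.fun_sum fun s (_ : s ∈ Finset.univ) =>
      (hp i i s).const_mul (α i * lam s)).fun_add
    ((HasDerivAt.fun_sum fun i (_ : i ∈ Finset.univ) =>
      HasDerivAt.fun_sum fun j (_ : j ∈ Finset.univ) =>
        ((hq i j).fun_mul (hq j i)).const_mul ((α i - α j) / (γ i - γ j))).const_mul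
          (2⁻¹ : ℝ))).fun_neg
  rw [h1.unique h2]
  simp only [zero_smul, add_zero]
  congr 2
  exact half_sum_symmetric (fun i j => by rw [← neg_sub (α j), ← neg_sub (γ j), neg_div_neg_eq])
    (fun i j => ∑ s, z.1 i s * z.2 j s) fun i j => ∑ s, (v.1 i s * z.2 j s + z.1 i s * v.2 j s)

lemma single_single_apply (a i : Fin 3) (r s : Fin N) :
    (Pi.single a (Pi.single r 1) : Fin 3 → Fin N → ℝ) i s =
      if i = a then if s = r then 1 else 0 else 0 := by
  rw [Pi.single_apply, ite_apply, Pi.single_apply, Pi.zero_apply]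

theorem spatialFlow_eq_hamiltonianField :
    spatialFlow α γ lam = hamiltonianField (spatialHamiltonian γ lam α) := by
  funext z
  refine Prod.ext ?_ ?_
  · funext a r
    simp only [hamiltonianField, dPsi, fderiv_spatialHamiltonian, spatialFlow, binaryField,
      matU_eq, potentialMatrix, single_single_apply]
    simp [Matrix.mulVec, dotProduct, constrainedPotential, Matrix.diagonal_apply, add_mul,
      Finset.sum_add_distrib, Finset.sum_ite_irrel]
    simp only [mul_assoc]
    ring
  · funext a r
    simp only [hamiltonianField, dPhi, fderiv_spatialHamiltonian, spatialFlow, binaryField,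
      matU_eq, potentialMatrix, single_single_apply]
    simp [Matrix.mulVec, dotProduct, constrainedPotential, Matrix.diagonal_apply, add_mul,
      Finset.sum_add_distrib, Finset.sum_ite_irrel]
    simp only [mul_assoc]
    ring

/-! ### Functional independence -/

/-- The Jacobian of the functions `F_{i,l+1}`, `l < N`, with respect to the coordinates `ψ`. -/
def jacobianPsi (z : Phase N) : Matrix (Fin 3 × Fin N) (Fin 3 × Fin N) ℝ :=
  Matrix.of fun p q => dPsi (F γ lam p.1 ((p.2 : ℕ) + 1)) z q.1 q.2

/-- The regularity `ω` is what the identity theorem needs. -/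
lemma contDiff_det_jacobianPsi :
    ContDiff ℝ ω fun z : Phase N => (jacobianPsi γ lam z).det := by
  simp only [Matrix.det_apply]
  refine ContDiff.sum fun σ _ => ContDiff.const_smul _ (contDiff_prod fun q _ => ?_)
  simp only [jacobianPsi, Matrix.of_apply, dPsi]
  exact ((contDiff_F γ lam ω _ _).fderiv_right (m := ω) le_rfl).clm_apply contDiff_const

/-- The values at the eigenvalues of `diagonal γ` of the gradients of the characteristic
coefficients. -/
def gradientMatrix : Matrix (Fin 3) (Fin 3) ℝ :=
  !![1, 1, 1; γ 1 + γ 2, γ 0 + γ 2, γ 0 + γ 1; γ 1 * γ 2, γ 0 * γ 2, γ 0 * γ 1]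

lemma det_gradientMatrix :
    (gradientMatrix γ).det = (γ 0 - γ 1) * (γ 0 - γ 2) * (γ 1 - γ 2) := by
  simp [gradientMatrix, Matrix.det_fin_three]
  ring

/-- At `Ψ = 0` the Lax series is the constant `diagonal γ`, so its gradients are constant too. The
coefficient of index `l + 1` then only picks `λ_s ^ l` from the pole series. -/
lemma jacobianPsi_base :
    jacobianPsi γ lam ((fun _ _ => 1), 0) =
      Matrix.kroneckerMap (· * ·) (gradientMatrix γ) (Matrix.vandermonde lam)ᵀ := by
  have hL : laxSeries γ lam ((fun _ _ => 1), 0) =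
      Matrix.diagonal fun a => PowerSeries.C (γ a) := by
    ext a b : 1
    rcases eq_or_ne a b with rfl | h <;> simp [laxSeries_apply, *]
  have hg : ∀ i a, (charGradient (Matrix.diagonal fun a => PowerSeries.C (γ a)) i *ᵥ
      fun _ => PowerSeries.C (1 : ℝ)) a = PowerSeries.C (gradientMatrix γ i a) := by
    intro i a
    fin_cases i <;> fin_cases a <;>
      simp [charGradient, gradientMatrix, Matrix.mulVec, dotProduct, Fin.sum_univ_three,
        Matrix.adjugate_fin_three, Matrix.one_apply,
        -Matrix.adjugate_diagonal] <;> ring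
  ext ⟨i, l⟩ ⟨a, s⟩
  rw [jacobianPsi, Matrix.of_apply, dPsi_F, hL, hg, PowerSeries.coeff_C_mul,
    coeff_succ_poleSeries]
  simp [Matrix.kroneckerMap_apply, Matrix.vandermonde_apply]

lemma det_jacobianPsi_base_ne_zero (hγ : Function.Injective γ) (hlam : Function.Injective lam) :
    (jacobianPsi γ lam ((fun _ _ => 1), 0)).det ≠ 0 := by
  have h : ∀ i j : Fin 3, i ≠ j → γ i - γ j ≠ 0 := fun i j hij => sub_ne_zero.2 (hγ.ne hij)
  rw [jacobianPsi_base, Matrix.det_kronecker, det_gradientMatrix, Matrix.det_transpose]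
  exact mul_ne_zero (pow_ne_zero _ (mul_ne_zero (mul_ne_zero (h _ _ (by decide))
    (h _ _ (by decide))) (h _ _ (by decide))))
    (pow_ne_zero _ (Matrix.det_vandermonde_ne_zero_iff.2 hlam))

theorem functionallyIndependent_F (hγ : Function.Injective γ) (hlam : Function.Injective lam) :
    FunctionallyIndependent
      (fun p : Fin 3 × Fin N => F γ lam p.1 ((p.2 : ℕ) + 1)) := by
  have hdet := contDiff_det_jacobianPsi γ lam
  refine ⟨{z | (jacobianPsi γ lam z).det ≠ 0}, isOpen_ne_fun hdet.continuous continuous_const,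
    fun z => ?_, fun z hz => ?_⟩
  -- Outside the closure the determinant would vanish near `z`, hence on the whole connected space,
  -- including the base point.
  · by_contra hz
    have h0 : (fun z => (jacobianPsi γ lam z).det) =ᶠ[nhds z] 0 := by
      rw [mem_closure_iff_frequently, Filter.not_frequently] at hz
      filter_upwards [hz] with y hy
      simpa using hy
    have han : AnalyticOnNhd ℝ (fun z => (jacobianPsi γ lam z).det) Set.univ :=
      contDiff_omega_iff_analyticOnNhd.1 hdet
    exact det_jacobianPsi_base_ne_zero γ lam hγ hlam
      (han.eqOn_zero_of_preconnected_of_eventuallyEq_zero isPreconnected_univ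
        (Set.mem_univ z) h0 (Set.mem_univ _))
  -- The derivatives in the `ψ` directions alone already separate the differentials.
  · refine LinearIndependent.of_comp (LinearMap.pi fun q : Fin 3 × Fin N =>
      (ContinuousLinearMap.apply ℝ ℝ
        ((0, Pi.single q.1 (Pi.single q.2 1)) : Phase N)).toLinearMap) ?_
    exact Matrix.linearIndependent_rows_of_det_ne_zero hz

theorem isLiouvilleIntegrable_spatialFlow (hγ : Function.Injective γ)
    (hlam : Function.Injective lam) : IsLiouvilleIntegrable (spatialFlow α γ lam) := by
  refine ⟨⟨_, contDiff_spatialHamiltonian γ lam α, spatialFlow_eq_hamiltonianField γ lam α⟩,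
    fun k => F γ lam (finProdFinEquiv.symm k).1 (((finProdFinEquiv.symm k).2 : ℕ) + 1),
    fun k => contDiff_F γ lam _ _ _, fun k => isIntegralOfMotion_F γ lam α hγ _ _,
    fun k l z => poisson_F_F γ lam _ _ _ _ z, ?_⟩
  obtain ⟨W, hWo, hWd, hW⟩ := functionallyIndependent_F γ lam hγ hlam
  exact ⟨W, hWo, hWd, fun z hz => (hW z hz).comp _ finProdFinEquiv.symm.injective⟩

end MultiWave

end

theorem theorem6p2 (N : ℕ) (α β γ : Fin 3 → ℝ) (lam : Fin N → ℝ)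
    (hα : Function.Injective α) (hβ : Function.Injective β) (hγ : Function.Injective γ)
    (hlam : Function.Injective lam) :
    -- the functions `F_{il}` are the coefficients of the expansions of the `𝓕_i` at infinity
    (∀ (i : Fin 3) (z : MultiWave.Phase N) (μ : ℝ), (∀ s, |lam s| < |μ|) →
      HasSum (fun l : ℕ => MultiWave.F γ lam i l z * μ⁻¹ ^ l)
        (MultiWave.charCoeff (MultiWave.laxMatrix γ lam z μ) i)) ∧
    (∀ (i : Fin 3) (l : ℕ), 1 ≤ l → ContDiff ℝ ∞ (MultiWave.F γ lam i l)) ∧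
    -- common integrals of motion
    (∀ (i : Fin 3) (l : ℕ), 1 ≤ l →
      MultiWave.IsIntegralOfMotion (MultiWave.spatialFlow α γ lam) (MultiWave.F γ lam i l) ∧
      MultiWave.IsIntegralOfMotion (MultiWave.temporalFlow α β γ lam) (MultiWave.F γ lam i l)) ∧
    -- involution
    (∀ (i j : Fin 3) (l k : ℕ), 1 ≤ l → 1 ≤ k → ∀ z : MultiWave.Phase N,
      MultiWave.poisson (MultiWave.F γ lam i l) (MultiWave.F γ lam j k) z = 0) ∧
    -- functional independence of the `F_{is}`, `1 ≤ s ≤ N`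
    MultiWave.FunctionallyIndependent
      (fun p : Fin 3 × Fin N => MultiWave.F γ lam p.1 ((p.2 : ℕ) + 1)) ∧
    MultiWave.IsLiouvilleIntegrable (MultiWave.spatialFlow α γ lam) ∧
    MultiWave.IsLiouvilleIntegrable (MultiWave.temporalFlow α β γ lam) := by
  rw [MultiWave.temporalFlow_eq_spatialFlow γ lam α β hα]
  exact ⟨fun i z μ hμ => MultiWave.hasSum_F γ lam hμ i,
    fun i l _ => MultiWave.contDiff_F γ lam _ i l,
    fun i l _ => ⟨MultiWave.isIntegralOfMotion_F γ lam α hγ i l,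
      MultiWave.isIntegralOfMotion_F γ lam β hγ i l⟩,
    fun i j l k _ _ z => MultiWave.poisson_F_F γ lam i j l k z,
    MultiWave.functionallyIndependent_F γ lam hγ hlam,
    MultiWave.isLiouvilleIntegrable_spatialFlow γ lam α hγ hlam,
    MultiWave.isLiouvilleIntegrable_spatialFlow γ lam β hγ hlam⟩
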